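/- Let $\mathscr H$ be a complex Hilbert space. Order the bounded self-adjoint operators on $\mathscr H$ by Löwner's order: $S\le T$ if and only if $(Su,u)\le (Tu,u)$ for all $u\in\mathscr H$; $S$ is called positive if $S\ge 0$. For positive bounded operators $A,B$ on $\mathscr H$ let $$A:B:=\lim_{\varepsilon\downarrow 0}\bigl((A+\varepsilon I)^{-1}+(B+\varepsilon I)^{-1}\bigr)^{-1}$$ denote their parallel sum and let $$[A]B:=\lim_{m\to\infty}(mA):B ,$$ where both limits exist in the strong operator topology. Let $n\ge 1$, let $\mathfrak M=\{A^{(1)},\dots,A^{(n)}\}$ be a finite set of positive bounded operators on $\mathscr H$, and let $S:=A^{(1)}:A^{(2)}:\cdots:A^{(n)}$ be the parallel sum of the operators of $\mathfrak M$ (formed successively from the left; $S=A^{(1)}$ if $n=1$). Let $\mathfrak L^{+}$ be the set of all positive bounded operators $L$ on $\mathscr H$ such that $L\le A^{(j)}$ for $j=1,\dots,n$. If there exists $k\in\{1,\dots,n\}$ such that $$[S]A^{(k)}\le [S]A^{(j)},\qquad j=1,\dots,n,$$ then $\mathfrak L^{+}$ has a greatest element, and it is equal to $[S]A^{(k)}$.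 -/

import Mathlib

open Filter Topology

section

variable {H : Type*} [NormedAddCommGroup H] [InnerProductSpace ℂ H] [CompleteSpace H]

/-- `T` is the limit of `F` along `l` in the strong operator topology. -/
def IsStrongLim {ι : Type*} (l : Filter ι) (F : ι → H →L[ℂ] H) (T : H →L[ℂ] H) : Prop :=
  ∀ x, Tendsto (fun i => F i x) l (𝓝 (T x))

open Classical in
/-- The limit of `F` along `l` in the strong operator topology (`0` if there is none). -/
noncomputable def strongLim {ι : Type*} (l : Filter ι) (F : ι → H →L[ℂ] H) : H →L[ℂ] H :=
  if h : ∃ T, IsStrongLim l F T then h.choose else 0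

/-- `((A + ε)⁻¹ + (B + ε)⁻¹)⁻¹`, the parallel sum of the operators `A + ε` and `B + ε`, which are
invertible if `A` and `B` are positive and `ε > 0`. -/
noncomputable def regParallelSum (A B : H →L[ℂ] H) (ε : ℝ) : H →L[ℂ] H :=
  Ring.inverse (Ring.inverse (A + (ε : ℂ) • 1) + Ring.inverse (B + (ε : ℂ) • 1))

/-- The parallel sum `A : B` of positive operators: the strong limit of
`((A + ε)⁻¹ + (B + ε)⁻¹)⁻¹` as `ε ↓ 0`. -/
noncomputable def parallelSum (A B : H →L[ℂ] H) : H →L[ℂ] H :=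
  strongLim (𝓝[>] (0 : ℝ)) (regParallelSum A B)

/-- The parallel sum `(⋯(A 0 : A 1) : ⋯) : A n` of finitely many positive operators. -/
noncomputable def parallelSumFin : (n : ℕ) → (Fin (n + 1) → H →L[ℂ] H) → H →L[ℂ] H
  | 0, A => A 0
  | n + 1, A =>
    parallelSum (parallelSumFin n (fun i => A i.castSucc)) (A (Fin.last (n + 1)))

/-- The operator `[A]B`: the strong limit of the parallel sums `(mA) : B` as `m → ∞`. -/
noncomputable def andoPart (A B : H →L[ℂ] H) : H →L[ℂ] H :=
  strongLim atTop (fun m : ℕ => parallelSum ((m : ℂ) • A) B)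

/-- The positive lower bounds of a set of operators with respect to the Loewner order. -/
def positiveLowerBounds (M : Set (H →L[ℂ] H)) : Set (H →L[ℂ] H) :=
  {L | L.IsPositive ∧ ∀ A ∈ M, L ≤ A}

/-! The limits in these definitions exist for positive operators. -/

set_option linter.unusedSectionVars false

theorem IsStrongLim.eq {ι : Type*} {l : Filter ι} [l.NeBot] {F : ι → H →L[ℂ] H}
    {S T : H →L[ℂ] H} (hS : IsStrongLim l F S) (hT : IsStrongLim l F T) : S = T := by
  ext x
  exact tendsto_nhds_unique (hS x) (hT x)

theorem isStrongLim_strongLim {ι : Type*} {l : Filter ι} {F : ι → H →L[ℂ] H}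
    (h : ∃ T, IsStrongLim l F T) : IsStrongLim l F (strongLim l F) := by
  rw [strongLim, dif_pos h]
  exact h.choose_spec

theorem IsStrongLim.le {ι : Type*} {l : Filter ι} [l.NeBot] {F G : ι → H →L[ℂ] H}
    {S T : H →L[ℂ] H} (hS : IsStrongLim l F S) (hT : IsStrongLim l G T)
    (h : ∀ᶠ i in l, F i ≤ G i) : S ≤ T := by
  rw [ContinuousLinearMap.le_def, ContinuousLinearMap.isPositive_iff_complex]
  intro x
  have h1 : Tendsto (fun i => inner ℂ ((G i - F i) x) x) l (𝓝 (inner ℂ ((T - S) x) x)) := by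
    simpa [inner_sub_left] using Filter.Tendsto.inner (𝕜 := ℂ) ((hT x).sub (hS x))
      (tendsto_const_nhds (x := x))
  have h2 : ∀ᶠ i in l, (((inner ℂ ((G i - F i) x) x).re : ℝ) : ℂ) = inner ℂ ((G i - F i) x) x ∧
      0 ≤ (inner ℂ ((G i - F i) x) x).re :=
    h.mono fun i hi => (ContinuousLinearMap.isPositive_iff_complex _).1 hi x
  have hre := (Complex.continuous_re.tendsto _).comp h1
  refine ⟨tendsto_nhds_unique (((Complex.continuous_ofReal.tendsto _).comp hre).congr' ?_) h1,
    ge_of_tendsto hre (h2.mono fun i hi => hi.2)⟩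
  exact h2.mono fun i hi => hi.1

/-- A bounded, eventually totally ordered family of operators whose quadratic forms converge
converges strongly. -/
theorem exists_isStrongLim {ι : Type*} {l : Filter ι} [l.NeBot] [l.IsCountablyGenerated]
    {F : ι → H →L[ℂ] H} {B : H →L[ℂ] H} {s : Set ι} (hs : s ∈ l)
    (h0 : ∀ i ∈ s, 0 ≤ F i) (hB : ∀ i ∈ s, F i ≤ B)
    (hc : ∀ i ∈ s, ∀ j ∈ s, F i ≤ F j ∨ F j ≤ F i)
    (hq : ∀ x, ∃ a, Tendsto (fun i => (inner ℂ (F i x) x).re) l (𝓝 a)) :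
    ∃ T, IsStrongLim l F T := by
  have key1 : ∀ D : H →L[ℂ] H, 0 ≤ D → D ≤ B → ∀ x,
      ‖D x‖ ^ 2 ≤ ‖B‖ * |(inner ℂ (D x) x).re| := by
    intro D hD hDB x
    have hn : ‖D‖ ≤ ‖B‖ := CStarAlgebra.norm_le_norm_of_nonneg_of_le hD hDB
    set R := CFC.sqrt D with hR
    have hRR : R * R = D := CFC.sqrt_mul_sqrt_self D hD
    have hRs : IsSelfAdjoint R := (CFC.sqrt_nonneg D).isSelfAdjoint
    have e1 : (inner ℂ (D x) x).re = ‖R x‖ ^ 2 := by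
      rw [← hRR, mul_apply_eq_comp, ← ContinuousLinearMap.adjoint_inner_right,
        hRs.adjoint_eq]
      exact inner_self_eq_norm_sq (𝕜 := ℂ) (R x)
    have e2 : ‖R‖ ^ 2 = ‖D‖ := by
      have := CStarRing.norm_star_mul_self (x := R)
      rw [hRs.star_eq, hRR] at this
      rw [this, sq]
    rw [e1, abs_of_nonneg (by positivity)]
    calc ‖D x‖ ^ 2 = ‖R (R x)‖ ^ 2 := by rw [← hRR]; rfl
      _ ≤ (‖R‖ * ‖R x‖) ^ 2 := by gcongr; exact R.le_opNorm _
      _ = ‖D‖ * ‖R x‖ ^ 2 := by rw [mul_pow, e2]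
      _ ≤ _ := by gcongr
  have key : ∀ i ∈ s, ∀ j ∈ s, ∀ x, ‖F i x - F j x‖ ^ 2 ≤
      ‖B‖ * |(inner ℂ (F i x) x).re - (inner ℂ (F j x) x).re| := by
    intro i hi j hj x
    rcases hc i hi j hj with h | h
    · have := key1 (F j - F i) (sub_nonneg.2 h)
        ((sub_le_self _ (h0 i hi)).trans (hB j hj)) x
      rw [norm_sub_rev, abs_sub_comm]
      simpa [inner_sub_left] using this
    · have := key1 (F i - F j) (sub_nonneg.2 h)
        ((sub_le_self _ (h0 j hj)).trans (hB i hi)) x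
      simpa [inner_sub_left] using this
  have hlim : ∀ x, ∃ y, Tendsto (fun i => F i x) l (𝓝 y) := by
    intro x
    obtain ⟨a, ha⟩ := hq x
    refine cauchy_map_iff_exists_tendsto.1 ?_
    rw [Metric.cauchy_iff]
    refine ⟨inferInstance, fun ε hε => ?_⟩
    have hδ : 0 < ε ^ 2 / (2 * (‖B‖ + 1)) := by positivity
    obtain ht := ha (Metric.ball_mem_nhds a hδ)
    refine ⟨(fun i => F i x) '' (s ∩ (fun i => (inner ℂ (F i x) x).re) ⁻¹' Metric.ball a
      (ε ^ 2 / (2 * (‖B‖ + 1)))), image_mem_map (inter_mem hs ht), ?_⟩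
    rintro _ ⟨i, ⟨hi, hi'⟩, rfl⟩ _ ⟨j, ⟨hj, hj'⟩, rfl⟩
    have h1 := key i hi j hj x
    have h2 : |(inner ℂ (F i x) x).re - (inner ℂ (F j x) x).re| < ε ^ 2 / (‖B‖ + 1) := by
      have := dist_triangle_right (inner ℂ (F i x) x).re (inner ℂ (F j x) x).re a
      rw [Real.dist_eq] at this
      have h3 : dist (inner ℂ (F i x) x).re a < ε ^ 2 / (2 * (‖B‖ + 1)) := hi'
      have h4 : dist (inner ℂ (F j x) x).re a < ε ^ 2 / (2 * (‖B‖ + 1)) := hj'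
      have h5 : ε ^ 2 / (‖B‖ + 1) =
        ε ^ 2 / (2 * (‖B‖ + 1)) + ε ^ 2 / (2 * (‖B‖ + 1)) := by field_simp; norm_num
      linarith
    rw [dist_eq_norm]
    refine lt_of_pow_lt_pow_left₀ 2 hε.le ?_
    have h6 : (‖B‖ + 1) * |(inner ℂ (F i x) x).re - (inner ℂ (F j x) x).re| < ε ^ 2 := by
      rwa [lt_div_iff₀' (by positivity)] at h2
    nlinarith [abs_nonneg ((inner ℂ (F i x) x).re - (inner ℂ (F j x) x).re)]
  choose f hf using hlim
  exact ⟨continuousLinearMapOfTendsto F (tendsto_pi_nhds.2 hf), hf⟩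

theorem isStrictlyPositive_add_smul {A : H →L[ℂ] H} (hA : 0 ≤ A) {ε : ℝ} (hε : 0 < ε) :
    IsStrictlyPositive (A + (ε : ℂ) • (1 : H →L[ℂ] H)) := by
  have h1 : IsStrictlyPositive ((ε : ℂ) • (1 : H →L[ℂ] H)) := by
    refine IsStrictlyPositive.iff_of_unital.2 ⟨?_, ?_⟩
    · rw [ContinuousLinearMap.nonneg_iff_isPositive]
      exact ContinuousLinearMap.isPositive_one.smul_of_nonneg (by exact_mod_cast hε.le)
    · exact (isUnit_one.smul (Units.mk0 (ε : ℂ) (by exact_mod_cast hε.ne')))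
  exact IsStrictlyPositive.of_le h1 (le_add_of_nonneg_left hA)

theorem isStrictlyPositive_regParallelSum_aux {A B : H →L[ℂ] H} (hA : 0 ≤ A) (hB : 0 ≤ B)
    {ε : ℝ} (hε : 0 < ε) :
    IsStrictlyPositive
      (Ring.inverse (A + (ε : ℂ) • 1) + Ring.inverse (B + (ε : ℂ) • 1)) := by
  have h1 := (isStrictlyPositive_add_smul hA hε).ringInverse
  have h2 := (isStrictlyPositive_add_smul hB hε).ringInverse
  exact IsStrictlyPositive.of_le h1 (le_add_of_nonneg_right h2.nonneg)

theorem regParallelSum_mono {A A' B B' : H →L[ℂ] H} (hA : 0 ≤ A) (hB : 0 ≤ B)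
    (hAA : A ≤ A') (hBB : B ≤ B') {ε δ : ℝ} (hε : 0 < ε) (hεδ : ε ≤ δ) :
    regParallelSum A B ε ≤ regParallelSum A' B' δ := by
  have h0 : (ε : ℂ) • (1 : H →L[ℂ] H) ≤ (δ : ℂ) • 1 := by
    rw [ContinuousLinearMap.le_def, ← sub_smul]
    refine ContinuousLinearMap.isPositive_one.smul_of_nonneg ?_
    rw [← Complex.ofReal_sub]
    exact_mod_cast sub_nonneg.2 hεδ
  refine CStarAlgebra.ringInverse_le_ringInverse (add_le_add ?_ ?_)
    (isStrictlyPositive_regParallelSum_aux (hA.trans hAA) (hB.trans hBB) (hε.trans_le hεδ))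
  · exact CStarAlgebra.ringInverse_le_ringInverse (add_le_add hAA h0)
      (isStrictlyPositive_add_smul hA hε)
  · exact CStarAlgebra.ringInverse_le_ringInverse (add_le_add hBB h0)
      (isStrictlyPositive_add_smul hB hε)

theorem regParallelSum_nonneg {A B : H →L[ℂ] H} (hA : 0 ≤ A) (hB : 0 ≤ B) {ε : ℝ}
    (hε : 0 < ε) : 0 ≤ regParallelSum A B ε :=
  (isStrictlyPositive_regParallelSum_aux hA hB hε).ringInverse.nonneg

theorem regParallelSum_le_right {A B : H →L[ℂ] H} (hA : 0 ≤ A) (hB : 0 ≤ B) {ε : ℝ}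
    (hε : 0 < ε) : regParallelSum A B ε ≤ B + (ε : ℂ) • 1 := by
  have h1 := isStrictlyPositive_add_smul hA hε
  have h2 := isStrictlyPositive_add_smul hB hε
  rw [← Ring.inverse_inverse h2.isUnit]
  exact CStarAlgebra.ringInverse_le_ringInverse
    (le_add_of_nonneg_left h1.ringInverse.nonneg) h2.ringInverse

theorem re_inner_mono {S T : H →L[ℂ] H} (h : S ≤ T) (x : H) :
    (inner ℂ (S x) x).re ≤ (inner ℂ (T x) x).re := by
  have := ((ContinuousLinearMap.isPositive_iff_complex _).1 h x).2
  simpa [inner_sub_left] using this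

/-- The limit defining `A : B` exists. -/
theorem isStrongLim_parallelSum {A B : H →L[ℂ] H} (hA : 0 ≤ A) (hB : 0 ≤ B) :
    IsStrongLim (𝓝[>] (0 : ℝ)) (regParallelSum A B) (parallelSum A B) := by
  refine isStrongLim_strongLim (exists_isStrongLim (B := B + ((1 : ℝ) : ℂ) • 1)
    (s := Set.Ioc 0 1) (Ioc_mem_nhdsGT one_pos) (fun i hi => regParallelSum_nonneg hA hB hi.1)
    (fun i hi => (regParallelSum_mono hA hB le_rfl le_rfl hi.1 hi.2).trans
      (regParallelSum_le_right hA hB one_pos)) (fun i hi j hj => ?_) fun x => ?_)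
  · rcases le_total i j with h | h
    · exact Or.inl (regParallelSum_mono hA hB le_rfl le_rfl hi.1 h)
    · exact Or.inr (regParallelSum_mono hA hB le_rfl le_rfl hj.1 h)
  · refine ⟨_, MonotoneOn.tendsto_nhdsGT (fun i hi j hj h => re_inner_mono
      (regParallelSum_mono hA hB le_rfl le_rfl hi h) x) ⟨0, ?_⟩⟩
    rintro _ ⟨i, hi, rfl⟩
    simpa using re_inner_mono (regParallelSum_nonneg hA hB hi) x

theorem parallelSum_nonneg {A B : H →L[ℂ] H} (hA : 0 ≤ A) (hB : 0 ≤ B) :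
    0 ≤ parallelSum A B :=
  IsStrongLim.le (F := fun _ => 0) (fun _ => tendsto_const_nhds) (isStrongLim_parallelSum hA hB)
    (eventually_nhdsWithin_of_forall fun _ hε => regParallelSum_nonneg hA hB hε)

theorem parallelSum_mono_left {A A' B : H →L[ℂ] H} (hA : 0 ≤ A) (hB : 0 ≤ B) (h : A ≤ A') :
    parallelSum A B ≤ parallelSum A' B :=
  (isStrongLim_parallelSum hA hB).le (isStrongLim_parallelSum (hA.trans h) hB)
    (eventually_nhdsWithin_of_forall fun _ hε =>
      regParallelSum_mono hA hB h le_rfl hε le_rfl)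

theorem parallelSum_le_right {A B : H →L[ℂ] H} (hA : 0 ≤ A) (hB : 0 ≤ B) :
    parallelSum A B ≤ B := by
  refine (isStrongLim_parallelSum hA hB).le (G := fun ε : ℝ => B + (ε : ℂ) • 1) (fun x => ?_)
    (eventually_nhdsWithin_of_forall fun _ hε => regParallelSum_le_right hA hB hε)
  have h : Continuous fun ε : ℝ => B x + (ε : ℂ) • x := by fun_prop
  simpa using (h.tendsto 0).mono_left nhdsWithin_le_nhds

theorem parallelSumFin_nonneg {n : ℕ} {A : Fin (n + 1) → H →L[ℂ] H} (hA : ∀ j, 0 ≤ A j) :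
    0 ≤ parallelSumFin n A := by
  induction n with
  | zero => exact hA 0
  | succ n ih => exact parallelSum_nonneg (ih fun _ => hA _) (hA _)

/-- The limit defining `[A]B` exists. -/
theorem isStrongLim_andoPart {A B : H →L[ℂ] H} (hA : 0 ≤ A) (hB : 0 ≤ B) :
    IsStrongLim atTop (fun m : ℕ => parallelSum ((m : ℂ) • A) B) (andoPart A B) := by
  have h0 : ∀ m : ℕ, 0 ≤ (m : ℂ) • A := fun m => by
    rw [ContinuousLinearMap.nonneg_iff_isPositive] at hA ⊢
    exact hA.smul_of_nonneg (by simpa using Complex.zero_le_real.2 (Nat.cast_nonneg (α := ℝ) m))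
  have hm : Monotone fun m : ℕ => parallelSum ((m : ℂ) • A) B := by
    refine monotone_nat_of_le_succ fun m => parallelSum_mono_left (h0 m) hB ?_
    simpa [add_smul] using hA
  refine isStrongLim_strongLim (exists_isStrongLim (B := B) univ_mem
    (fun m _ => parallelSum_nonneg (h0 m) hB) (fun m _ => parallelSum_le_right (h0 m) hB)
    (fun i _ j _ => (le_total i j).imp (fun h => hm h) fun h => hm h) fun x => ?_)
  have hb : BddAbove (Set.range fun m : ℕ =>
      (inner ℂ ((parallelSum ((m : ℂ) • A) B) x) x).re) := by
    refine ⟨(inner ℂ (B x) x).re, ?_⟩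
    rintro _ ⟨m, rfl⟩
    exact re_inner_mono (parallelSum_le_right (h0 m) hB) x
  exact ⟨_, tendsto_atTop_ciSup (fun i j h => re_inner_mono (hm h) x) hb⟩

end

section

variable {H : Type*} [NormedAddCommGroup H] [InnerProductSpace ℂ H] [CompleteSpace H]

/-! Everything rests on `(aL) : L = (a / (a + 1)) L` for `a > 0`, of which only `≥` is needed
(`smul_le_parallelSum_smul_self`), and on monotonicity of the parallel sum. If `0 ≤ L ≤ A j` for all
`j`, iterating these gives `cL ≤ S` for some `c > 0` (`exists_smul_le_parallelSumFin`). Hence `(mS)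
: A k ≥ (mcL) : L ≥ (mc / (mc + 1)) L`, and `m → ∞` yields `L ≤ [S](A k)` (`le_andoPart`). This
bound holds for every index; the minimality of `k` serves to make `[S](A k)` itself a lower bound,
through `[S](A k) ≤ [S](A j) ≤ A j`. -/

theorem ofReal_smul_nonneg {a : ℝ} (ha : 0 ≤ a) {L : H →L[ℂ] H} (hL : 0 ≤ L) :
    0 ≤ (a : ℂ) • L := by
  rw [ContinuousLinearMap.nonneg_iff_isPositive] at hL ⊢
  exact hL.smul_of_nonneg (Complex.zero_le_real.2 ha)

theorem ofReal_smul_le_smul {a : ℝ} (ha : 0 ≤ a) {L M : H →L[ℂ] H} (h : L ≤ M) :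
    (a : ℂ) • L ≤ (a : ℂ) • M := by
  rw [← sub_nonneg, ← smul_sub]
  exact ofReal_smul_nonneg ha (sub_nonneg.2 h)

theorem ofReal_smul_mono {a b : ℝ} (hab : a ≤ b) {L : H →L[ℂ] H} (hL : 0 ≤ L) :
    (a : ℂ) • L ≤ (b : ℂ) • L := by
  rw [← sub_nonneg, ← sub_smul, ← Complex.ofReal_sub]
  exact ofReal_smul_nonneg (sub_nonneg.2 hab) hL

theorem parallelSum_mono {A A' B B' : H →L[ℂ] H} (hA : 0 ≤ A) (hB : 0 ≤ B) (hAA : A ≤ A')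
    (hBB : B ≤ B') : parallelSum A B ≤ parallelSum A' B' :=
  (isStrongLim_parallelSum hA hB).le (isStrongLim_parallelSum (hA.trans hAA) (hB.trans hBB))
    (eventually_nhdsWithin_of_forall fun _ hε => regParallelSum_mono hA hB hAA hBB hε le_rfl)

theorem ringInverse_ofReal_smul {a : ℝ} (ha : 0 < a) {X : H →L[ℂ] H} (hX : IsUnit X) :
    Ring.inverse ((a : ℂ) • X) = ((a⁻¹ : ℝ) : ℂ) • Ring.inverse X := by
  have hu : IsUnit ((a : ℂ) • X) := hX.smul (Units.mk0 (a : ℂ) (by exact_mod_cast ha.ne'))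
  have ha' : (a : ℂ) ≠ 0 := by exact_mod_cast ha.ne'
  refine hu.mul_left_cancel ?_
  rw [Ring.mul_inverse_cancel _ hu, smul_mul_smul_comm, Ring.mul_inverse_cancel _ hX,
    Complex.ofReal_inv, mul_inv_cancel₀ ha', one_smul]

/-- The shift by `ε` does not scale with `a`, so `aL + ε` is not a multiple of `L + ε`. Both terms
are instead bounded below by multiples of one invertible `X = L + δ`, for which `((aX)⁻¹ + X⁻¹)⁻¹ =
(a / (a + 1)) X ≥ (a / (a + 1)) L`. -/
theorem smul_le_regParallelSum_smul_self {L : H →L[ℂ] H} (hL : 0 ≤ L) {a : ℝ} (ha : 0 < a)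
    {ε : ℝ} (hε : 0 < ε) :
    ((a / (a + 1) : ℝ) : ℂ) • L ≤ regParallelSum ((a : ℂ) • L) L ε := by
  have h1 : (0 : H →L[ℂ] H) ≤ 1 :=
    ContinuousLinearMap.nonneg_iff_isPositive _ |>.2 ContinuousLinearMap.isPositive_one
  -- This choice gives both `δ ≤ ε` and `aδ ≤ ε`, whether `a` is small or large.
  set δ : ℝ := ε / (a + 1) with hδ
  have hδ0 : 0 < δ := by positivity
  have hδε : δ ≤ ε := div_le_self hε.le (by linarith)
  have haδ : a * δ ≤ ε := by
    rw [hδ, mul_div_assoc', div_le_iff₀ (by positivity)]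
    nlinarith
  set X : H →L[ℂ] H := L + (δ : ℂ) • 1 with hX
  have hXp : IsStrictlyPositive X := isStrictlyPositive_add_smul hL hδ0
  have haX : IsStrictlyPositive ((a : ℂ) • X) := by
    rw [hX, smul_add, smul_smul, ← Complex.ofReal_mul]
    exact isStrictlyPositive_add_smul (ofReal_smul_nonneg ha.le hL) (by positivity)
  have hle : Ring.inverse ((a : ℂ) • L + (ε : ℂ) • 1) + Ring.inverse (L + (ε : ℂ) • 1) ≤
      Ring.inverse ((a : ℂ) • X) + Ring.inverse X := by
    refine add_le_add (CStarAlgebra.ringInverse_le_ringInverse ?_ haX)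
      (CStarAlgebra.ringInverse_le_ringInverse ?_ hXp)
    · rw [hX, smul_add, smul_smul, ← Complex.ofReal_mul]
      exact add_le_add le_rfl (ofReal_smul_mono haδ h1)
    · exact add_le_add le_rfl (ofReal_smul_mono hδε h1)
  have hsum : Ring.inverse ((a : ℂ) • X) + Ring.inverse X =
      ((a⁻¹ + 1 : ℝ) : ℂ) • Ring.inverse X := by
    rw [ringInverse_ofReal_smul ha hXp.isUnit]
    push_cast
    rw [add_smul, one_smul]
  have hinv : Ring.inverse (Ring.inverse ((a : ℂ) • X) + Ring.inverse X) =
      ((a / (a + 1) : ℝ) : ℂ) • X := by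
    rw [hsum, ringInverse_ofReal_smul (by positivity) hXp.ringInverse.isUnit,
      Ring.inverse_inverse hXp.isUnit]
    congr 2
    field_simp
    ring
  calc ((a / (a + 1) : ℝ) : ℂ) • L ≤ ((a / (a + 1) : ℝ) : ℂ) • X :=
        ofReal_smul_le_smul (by positivity)
          (le_add_of_nonneg_right (ofReal_smul_nonneg hδ0.le h1))
    _ = Ring.inverse (Ring.inverse ((a : ℂ) • X) + Ring.inverse X) := hinv.symm
    _ ≤ regParallelSum ((a : ℂ) • L) L ε :=
        CStarAlgebra.ringInverse_le_ringInverse hle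
          (isStrictlyPositive_regParallelSum_aux (ofReal_smul_nonneg ha.le hL) hL hε)

theorem smul_le_parallelSum_smul_self {L : H →L[ℂ] H} (hL : 0 ≤ L) {a : ℝ} (ha : 0 < a) :
    ((a / (a + 1) : ℝ) : ℂ) • L ≤ parallelSum ((a : ℂ) • L) L :=
  IsStrongLim.le (F := fun _ => ((a / (a + 1) : ℝ) : ℂ) • L) (fun _ => tendsto_const_nhds)
    (isStrongLim_parallelSum (ofReal_smul_nonneg ha.le hL) hL)
    (eventually_nhdsWithin_of_forall fun _ hε => smul_le_regParallelSum_smul_self hL ha hε)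

/-- A positive lower bound of finitely many operators is dominated by their parallel sum. -/
theorem exists_smul_le_parallelSumFin {n : ℕ} {A : Fin (n + 1) → H →L[ℂ] H} {L : H →L[ℂ] H}
    (hL : 0 ≤ L) (hLA : ∀ j, L ≤ A j) : ∃ c : ℝ, 0 < c ∧ (c : ℂ) • L ≤ parallelSumFin n A := by
  induction n with
  | zero => exact ⟨1, one_pos, by simpa [parallelSumFin] using hLA 0⟩
  | succ n ih =>
    obtain ⟨c, hc, h⟩ := ih (A := fun i => A i.castSucc) fun _ => hLA _
    -- By monotonicity the new parallel sum dominates `(cL) : L`. Starting from `c = 1`, the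
    -- recursion `c ↦ c / (c + 1)` produces `1 / (n + 1)`.
    exact ⟨c / (c + 1), by positivity, (smul_le_parallelSum_smul_self hL hc).trans
      (parallelSum_mono (ofReal_smul_nonneg hc.le hL) hL h (hLA _))⟩

theorem andoPart_nonneg {A B : H →L[ℂ] H} (hA : 0 ≤ A) (hB : 0 ≤ B) : 0 ≤ andoPart A B :=
  IsStrongLim.le (F := fun _ => 0) (fun _ => tendsto_const_nhds) (isStrongLim_andoPart hA hB)
    (Eventually.of_forall fun m => parallelSum_nonneg
      (by simpa using ofReal_smul_nonneg (Nat.cast_nonneg (α := ℝ) m) hA) hB)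

theorem andoPart_le_right {A B : H →L[ℂ] H} (hA : 0 ≤ A) (hB : 0 ≤ B) : andoPart A B ≤ B :=
  (isStrongLim_andoPart hA hB).le (G := fun _ => B) (fun _ => tendsto_const_nhds)
    (Eventually.of_forall fun m => parallelSum_le_right
      (by simpa using ofReal_smul_nonneg (Nat.cast_nonneg (α := ℝ) m) hA) hB)

/-- `[A]B` dominates every positive `L ≤ B` that is dominated by a multiple of `A`. -/
theorem le_andoPart {A B L : H →L[ℂ] H} (hL : 0 ≤ L) (hA : 0 ≤ A) (hLB : L ≤ B) {c : ℝ}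
    (hc : 0 < c) (hcA : (c : ℂ) • L ≤ A) : L ≤ andoPart A B := by
  refine IsStrongLim.le (l := atTop)
    (F := fun m : ℕ => (((m * c) / (m * c + 1) : ℝ) : ℂ) • L) (fun x => ?_)
    (isStrongLim_andoPart hA (hL.trans hLB)) ?_
  · have h1 : Tendsto (fun m : ℕ => (m : ℝ) * c + 1) atTop atTop :=
      tendsto_atTop_add_const_right _ _
        (tendsto_natCast_atTop_atTop.atTop_mul_const hc)
    have h2 : Tendsto (fun m : ℕ => ((m * c) / (m * c + 1) : ℝ)) atTop (𝓝 1) := by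
      -- The coefficient is written as `1 - (mc + 1)⁻¹`.
      have h3 := h1.inv_tendsto_atTop.const_sub 1
      rw [sub_zero] at h3
      refine h3.congr fun m => ?_
      have : (m : ℝ) * c + 1 ≠ 0 := by positivity
      simp only [Pi.inv_apply]
      field_simp
      ring
    have h4 := ((Complex.continuous_ofReal.tendsto _).comp h2).smul_const (L x)
    simpa using h4
  -- `m ≥ 1` makes `a = mc` positive; then `(mcL) : L ≤ (mS) : B`, with `A` in the role of `S`.
  · filter_upwards [eventually_ge_atTop 1] with m hm
    have hm' : (0 : ℝ) < m := by exact_mod_cast hm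
    refine (smul_le_parallelSum_smul_self hL (mul_pos hm' hc)).trans
      (parallelSum_mono (ofReal_smul_nonneg (by positivity) hL) hL ?_ hLB)
    have := ofReal_smul_le_smul hm'.le hcA
    rwa [smul_smul, ← Complex.ofReal_mul, Complex.ofReal_natCast] at this

end

theorem theorem6p13 {H : Type*} [NormedAddCommGroup H] [InnerProductSpace ℂ H] [CompleteSpace H]
    {n : ℕ} (A : Fin (n + 1) → H →L[ℂ] H) (hA : ∀ j, (A j).IsPositive)
    (S : H →L[ℂ] H) (hS : S = parallelSumFin n A)
    (k : Fin (n + 1)) (hk : ∀ j, andoPart S (A k) ≤ andoPart S (A j)) :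
    IsGreatest (positiveLowerBounds (Set.range A)) (andoPart S (A k)) := by
  have hA0 : ∀ j, 0 ≤ A j := fun j => (ContinuousLinearMap.nonneg_iff_isPositive _).2 (hA j)
  have hS0 : 0 ≤ S := hS ▸ parallelSumFin_nonneg hA0
  refine ⟨⟨(ContinuousLinearMap.nonneg_iff_isPositive _).1 (andoPart_nonneg hS0 (hA0 k)), ?_⟩, ?_⟩
  · rintro _ ⟨j, rfl⟩
    -- The only point where the minimality of `[S](A k)` enters.
    exact (hk j).trans (andoPart_le_right hS0 (hA0 j))
  · rintro L ⟨hL, hLA⟩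
    have hL0 : 0 ≤ L := (ContinuousLinearMap.nonneg_iff_isPositive _).2 hL
    have hLA' : ∀ j, L ≤ A j := fun j => hLA _ ⟨j, rfl⟩
    obtain ⟨c, hc, h⟩ := exists_smul_le_parallelSumFin hL0 hLA'
    exact le_andoPart hL0 hS0 (hLA' k) hc (hS ▸ h)
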